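/- Let $A_1,\dots,A_n$ be invertible complex $N\times N$ matrices and $A(x)=x_1A_1+\dots+x_nA_n-x_{n+1}I$. Write $\det A(x)=R_1(x)^{m_1}\cdots R_k(x)^{m_k}$ with $m_s\ge 1$ and $R_1,\dots,R_k$ pairwise non-proportional irreducible homogeneous polynomials, and let $\sigma(A)=\{x\in\mathbb{CP}^n:\det A(x)=0\}$ be the projective joint spectrum of $A=(A_1,\dots,A_n)$ (with $-I$ appended). For $1\le j\le n$ let $L_j=\{[0:\cdots:0:x_j:0:\cdots:0:1]: x_j\in\mathbb C\}$. For a complex $n\times n$ matrix $C=(c_{js})$ put $\widehat A_j=\sum_{s=1}^n c_{js}A_s$, $\widehat A=(\widehat A_1,\dots,\widehat A_n)$ and $\mathscr C=\begin{pmatrix}C&0\\0&1\end{pmatrix}$. Call $C$ admissible (for $A$) if (1) $C$ is invertible and, in case all $A_j$ are self-adjoint, $C$ is real-valued; and (2) for each $1\le j\le n$, $\frac{\partial}{\partial x_j}\prod_{s=1}^kR_s(x\mathscr C)\neq 0$ at every point of $\sigma(\widehat A)\cap L_j$ ($x$ being a row vector). Then every neighbourhood of the identity matrix contains an admissible $C$.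 In fact, there is an open neighbourhood $U$ of the identity in the space of complex $n\times n$ matrices such that the admissible matrices in $U$ form an open dense subset of $U$ if not all $A_j$ are self-adjoint, and an open dense subset of the set of real matrices in $U$ if all $A_j$ are self-adjoint. Moreover, for every admissible $C$ and every $j$, each point of $\sigma(\widehat A)\cap L_j$ is a regular point of the hypersurface $\sigma(\widehat A)$. -/

import Mathlib

open scoped LinearAlgebra.Projectivization Topology

noncomputable section

namespace JointSpectrum

variable {n N : ℕ}

/-- The linear pencil `A(x) = x₁ A₁ + ⋯ + xₙ Aₙ - xₙ₊₁ I` of a tuple of `N × N` matrices.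
The last coordinate of `x : Fin (n + 1) → ℂ` is `xₙ₊₁`. -/
def pencil (A : Fin n → Matrix (Fin N) (Fin N) ℂ) (x : Fin (n + 1) → ℂ) :
    Matrix (Fin N) (Fin N) ℂ :=
  ∑ j : Fin n, x j.castSucc • A j - x (Fin.last n) • (1 : Matrix (Fin N) (Fin N) ℂ)

/-- `det A(x)` as a polynomial in the variables `x₁, …, xₙ₊₁`. -/
def detPoly (A : Fin n → Matrix (Fin N) (Fin N) ℂ) : MvPolynomial (Fin (n + 1)) ℂ :=
  (∑ j : Fin n, (MvPolynomial.X j.castSucc : MvPolynomial (Fin (n + 1)) ℂ) •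
      (A j).map (MvPolynomial.C : ℂ →+* MvPolynomial (Fin (n + 1)) ℂ)
    - (MvPolynomial.X (Fin.last n) : MvPolynomial (Fin (n + 1)) ℂ) •
      (1 : Matrix (Fin N) (Fin N) (MvPolynomial (Fin (n + 1)) ℂ))).det

/-- The projective joint spectrum `σ(A) ⊆ ℂℙⁿ` of the tuple `(A₁, …, Aₙ, -I)`. -/
def spec (A : Fin n → Matrix (Fin N) (Fin N) ℂ) : Set (ℙ ℂ (Fin (n + 1) → ℂ)) :=
  {p | (pencil A p.rep).det = 0}

theorem pencil_smul (A : Fin n → Matrix (Fin N) (Fin N) ℂ) (a : ℂ) (x : Fin (n + 1) → ℂ) :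
    pencil A (a • x) = a • pencil A x := by
  simp [pencil, smul_sub, Finset.smul_sum, mul_smul]

/-- Membership in the joint spectrum does not depend on the homogeneous coordinates. -/
theorem mk_mem_spec (A : Fin n → Matrix (Fin N) (Fin N) ℂ) (x : Fin (n + 1) → ℂ) (hx : x ≠ 0) :
    Projectivization.mk ℂ x hx ∈ spec A ↔ (pencil A x).det = 0 := by
  obtain ⟨a, ha⟩ := Projectivization.exists_smul_eq_mk_rep ℂ x hx
  have h : pencil A (Projectivization.mk ℂ x hx).rep = (a : ℂ) • pencil A x := by
    rw [← ha, Units.smul_def, pencil_smul]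
  simp [spec, h]

/-- The coordinate line `Lⱼ = {[0 : ⋯ : xⱼ : 0 : ⋯ : 1] : xⱼ ∈ ℂ}`. -/
def coordLine (j : Fin n) : Set (ℙ ℂ (Fin (n + 1) → ℂ)) :=
  {p | ∃ (t : ℂ) (h : (Pi.single j.castSucc t + Pi.single (Fin.last n) 1 : Fin (n + 1) → ℂ) ≠ 0),
    p = Projectivization.mk ℂ (Pi.single j.castSucc t + Pi.single (Fin.last n) 1) h}

/-- The transformed tuple `Âⱼ = ∑ₛ cⱼₛ Aₛ`. -/
def transform (C : Matrix (Fin n) (Fin n) ℂ) (A : Fin n → Matrix (Fin N) (Fin N) ℂ) :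
    Fin n → Matrix (Fin N) (Fin N) ℂ :=
  fun j => ∑ s : Fin n, C j s • A s

/-- The `(n+1) × (n+1)` matrix obtained from `C` by adding the last column `(0, …, 0, 1)ᵀ`
and the last row `(0, …, 0, 1)`. -/
def border (C : Matrix (Fin n) (Fin n) ℂ) : Matrix (Fin (n + 1)) (Fin (n + 1)) ℂ :=
  Matrix.reindex finSumFinEquiv finSumFinEquiv
    (Matrix.fromBlocks C 0 0 (1 : Matrix (Fin 1) (Fin 1) ℂ))

/-- The polynomial `R(x M)`, where `x = (x₁, …, xₙ₊₁)` is a row vector. -/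
def substRow (M : Matrix (Fin (n + 1)) (Fin (n + 1)) ℂ) (R : MvPolynomial (Fin (n + 1)) ℂ) :
    MvPolynomial (Fin (n + 1)) ℂ :=
  MvPolynomial.bind₁
    (fun i => ∑ j : Fin (n + 1), MvPolynomial.X j * MvPolynomial.C (M j i)) R

/-- `det A(x) = R₁^{m₁} ⋯ R_k^{m_k}` is the factorization into powers of distinct (that is,
pairwise non-proportional) irreducible homogeneous polynomials `Rₛ` of degree `lₛ`. -/
structure IsFactorization (A : Fin n → Matrix (Fin N) (Fin N) ℂ) {k : ℕ}
    (R : Fin k → MvPolynomial (Fin (n + 1)) ℂ) (l m : Fin k → ℕ) : Prop where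
  irreducible : ∀ s, Irreducible (R s)
  homogeneous : ∀ s, (R s).IsHomogeneous (l s)
  distinct : ∀ s t, s ≠ t → ¬ Associated (R s) (R t)
  mult_pos : ∀ s, 0 < m s
  det_eq : detPoly A = ∏ s, R s ^ m s

/-- The matrices `C` allowed by the reality requirement: if the tuple `A` consists of self-adjoint
matrices, `C` has to be real-valued; otherwise every complex matrix is allowed. -/
def allowed (A : Fin n → Matrix (Fin N) (Fin N) ℂ) : Set (Matrix (Fin n) (Fin n) ℂ) :=
  {C | (∀ j, (A j).IsHermitian) → ∀ i j, (C i j).im = 0}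

/-- The transformation with matrix `C` is admissible for the tuple `A`, where `R₁, …, R_k` are the
distinct irreducible factors of `det A(x)`. -/
structure IsAdmissible (A : Fin n → Matrix (Fin N) (Fin N) ℂ) {k : ℕ}
    (R : Fin k → MvPolynomial (Fin (n + 1)) ℂ) (C : Matrix (Fin n) (Fin n) ℂ) : Prop where
  invertible : IsUnit C
  real : C ∈ allowed A
  deriv_ne_zero : ∀ (j : Fin n) (x : Fin (n + 1) → ℂ) (hx : x ≠ 0),
    Projectivization.mk ℂ x hx ∈ spec (transform C A) ∩ coordLine j →
      MvPolynomial.eval x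
        (MvPolynomial.pderiv j.castSucc (∏ s, substRow (border C) (R s))) ≠ 0

/-- `p` is a regular point of the projective hypersurface `Z ⊆ ℂℙⁿ`: some homogeneous
polynomial in the vanishing ideal of `Z` has a nonzero gradient at `p`. -/
def IsRegularPoint (Z : Set (ℙ ℂ (Fin (n + 1) → ℂ))) (p : ℙ ℂ (Fin (n + 1) → ℂ)) : Prop :=
  p ∈ Z ∧ ∃ (G : MvPolynomial (Fin (n + 1)) ℂ) (d : ℕ), G.IsHomogeneous d ∧
    (∀ q ∈ Z, MvPolynomial.eval q.rep G = 0) ∧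
    ∃ i, MvPolynomial.eval p.rep (MvPolynomial.pderiv i G) ≠ 0

end JointSpectrum

end

noncomputable section

namespace JointSpectrum

open MvPolynomial

variable {n N : ℕ}

/-! ### Separability and the resultant with the derivative -/

/-! Put `F = ∏ s, R s`, the radical of the determinant. On the line `L_j` the substitution by `C`
sees only the row `c_j`, so condition (2) says that the zeros `t` of `F(t c_j, 1)` are simple. With
`s = 1/t`, homogeneity and Euler's identity turn this into simplicity of the zeros of `F(c_j, s)` in
`s`, as long as `F(c_j, 0) ≠ 0` (`simple_zeros_iff`). For `C = 1` that proviso is the invertibility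
of `A_j`, and it persists nearby (`goodNhd`).

Up to sign, `det A(x)` is a characteristic polynomial in the last variable, so its divisor `F` has
unit leading coefficient there. Simplicity then means that the single polynomial `discPoly` is
nonzero at `c_j`. It is not the zero polynomial, because `F` is a product of non-associated
irreducibles, hence separable over the fraction field by Gauss's lemma in characteristic zero.

Near the identity, admissibility is thus `∏ j, discPoly(c_j) ≠ 0`. This is an open condition, and a
dense one even among real matrices, since a nonzero polynomial cannot vanish on all real points.
Regularity is witnessed by `F(x 𝒞)` itself. -/

/-- A unit leading coefficient and characteristic zero keep the degrees of `P` and `P'` unchanged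
under `φ`, so the resultant commutes with specialization. -/
theorem separable_map_iff_resultant_ne_zero {S K : Type*} [CommRing S] [IsDomain S] [CharZero S]
    [Field K] [CharZero K] (φ : S →+* K) (P : Polynomial S) (hP : IsUnit P.leadingCoeff) :
    (P.map φ).Separable ↔ φ (P.resultant P.derivative) ≠ 0 := by
  have h1 : (P.map φ).natDegree = P.natDegree :=
    Polynomial.natDegree_map_eq_of_isUnit_leadingCoeff φ hP
  have h2 : (P.map φ).derivative.natDegree = P.derivative.natDegree := by
    rw [Polynomial.natDegree_derivative, Polynomial.natDegree_derivative, h1]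
  have h0 : P.map φ ≠ 0 := by
    intro h
    have h3 := Polynomial.leadingCoeff_map_eq_of_isUnit_leadingCoeff φ hP
    rw [h, Polynomial.leadingCoeff_zero] at h3
    exact (hP.map φ).ne_zero h3.symm
  have h4 : φ (P.resultant P.derivative) =
      (P.map φ).resultant (P.map φ).derivative := by
    rw [h1, h2, Polynomial.derivative_map, Polynomial.resultant_map_map]
  rw [h4, Ne, Polynomial.resultant_eq_zero_iff, Polynomial.separable_def]
  tauto

theorem separable_iff_forall_root {P : Polynomial ℂ} :
    P.Separable ↔ ∀ s, P.eval s = 0 → P.derivative.eval s ≠ 0 := by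
  rw [Polynomial.separable_def,
    Polynomial.isCoprime_iff_aeval_ne_zero_of_isAlgClosed (k := ℂ) (K := ℂ)]
  refine forall_congr' fun s => ?_
  simp only [Polynomial.coe_aeval_eq_eval]
  tauto

/-- Gauss's lemma: primitive irreducibles stay irreducible over `K`, and divisibility there descends
to `S`, so the factors are pairwise coprime. Each is separable in characteristic zero. -/
theorem separable_map_prod_fractionRing {S K ι : Type*} [CommRing S] [IsDomain S]
    [NormalizedGCDMonoid S] [Field K] [CharZero K] [Algebra S K] [IsFractionRing S K] [Fintype ι]
    (P : ι → Polynomial S) (hprim : ∀ i, (P i).IsPrimitive) (hirr : ∀ i, Irreducible (P i))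
    (hdist : ∀ i j, i ≠ j → ¬ Associated (P i) (P j)) :
    ((∏ i, P i).map (algebraMap S K)).Separable := by
  rw [Polynomial.map_prod]
  have hK : ∀ i, Irreducible ((P i).map (algebraMap S K)) := fun i =>
    (hprim i).irreducible_iff_irreducible_map_fraction_map.1 (hirr i)
  refine Polynomial.separable_prod (fun i j hij => ?_) fun i => (hK i).separable
  refine ((hK i).coprime_iff_not_dvd).2 fun hd => hdist i j hij ?_
  exact (hirr i).associated_of_dvd (hirr j)
    ((hprim i).dvd_of_fraction_map_dvd_fraction_map hd)

/-! ### Polynomials in the last variable -/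

/-- Polynomials in `x₁, …, xₙ₊₁` as polynomials in `xₙ₊₁` over `ℂ[x₁, …, xₙ]`. -/
def lastVarEquiv (n : ℕ) :
    MvPolynomial (Fin (n + 1)) ℂ ≃ₐ[ℂ] Polynomial (MvPolynomial (Fin n) ℂ) :=
  (renameEquiv ℂ finSuccEquivLast).trans (optionEquivLeft ℂ (Fin n))

@[simp]
theorem lastVarEquiv_X_castSucc (i : Fin n) :
    lastVarEquiv n (X i.castSucc) = Polynomial.C (X i) := by
  simp [lastVarEquiv]

@[simp]
theorem lastVarEquiv_X_last : lastVarEquiv n (X (Fin.last n)) = Polynomial.X := by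
  simp [lastVarEquiv]

@[simp]
theorem lastVarEquiv_C (a : ℂ) : lastVarEquiv n (C a) = Polynomial.C (C a) := by
  simp [lastVarEquiv]

theorem eval_map_lastVarEquiv (c : Fin n → ℂ) (s : ℂ) (p : MvPolynomial (Fin (n + 1)) ℂ) :
    ((lastVarEquiv n p).map (eval c)).eval s =
      eval (Fin.snoc c s : Fin (n + 1) → ℂ) p := by
  induction p using MvPolynomial.induction_on with
  | C a => simp
  | add p q hp hq => simp [hp, hq]
  | mul_X p i hp =>
    rw [map_mul, Polynomial.map_mul, Polynomial.eval_mul, hp, map_mul]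
    refine Fin.lastCases ?_ (fun i => ?_) i <;> simp

theorem lastVarEquiv_pderiv_last (p : MvPolynomial (Fin (n + 1)) ℂ) :
    lastVarEquiv n (pderiv (Fin.last n) p) = (lastVarEquiv n p).derivative := by
  induction p using MvPolynomial.induction_on with
  | C a => simp
  | add p q hp hq => simp [hp, hq]
  | mul_X p i hp =>
    rw [Derivation.leibniz, map_add, smul_eq_mul, smul_eq_mul, map_mul, map_mul, map_mul, hp,
      Polynomial.derivative_mul]
    refine Fin.lastCases ?_ (fun i => ?_) i
    · simp; ring
    · simp [pderiv_X_of_ne (Fin.castSucc_lt_last i).ne]; ring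

/-! ### Homogeneous polynomials -/

theorem eval_smul_of_isHomogeneous {σ : Type*} {F : MvPolynomial σ ℂ} {d : ℕ}
    (hF : F.IsHomogeneous d) (a : ℂ) (x : σ → ℂ) : eval (a • x) F = a ^ d * eval x F := by
  rw [eval_eq, eval_eq, Finset.mul_sum]
  refine Finset.sum_congr rfl fun m hm => ?_
  have hd : ∑ i ∈ m.support, m i = d := (hF.degree_eq_sum_deg_support hm).symm
  simp only [Pi.smul_apply, smul_eq_mul, mul_pow, Finset.prod_mul_distrib,
    Finset.prod_pow_eq_pow_sum, hd]
  ring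

theorem smul_snoc (a : ℂ) (c : Fin n → ℂ) (s : ℂ) :
    a • (Fin.snoc c s : Fin (n + 1) → ℂ) = Fin.snoc (a • c) (a * s) := by
  ext i
  refine Fin.lastCases ?_ (fun i => ?_) i <;> simp

theorem euler_snoc {F : MvPolynomial (Fin (n + 1)) ℂ} {d : ℕ} (hF : F.IsHomogeneous d)
    (c : Fin n → ℂ) (t : ℂ) :
    t * ∑ i, c i * eval (Fin.snoc (t • c) 1 : Fin (n + 1) → ℂ) (pderiv i.castSucc F)
      + eval (Fin.snoc (t • c) 1 : Fin (n + 1) → ℂ) (pderiv (Fin.last n) F)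
      = d * eval (Fin.snoc (t • c) 1 : Fin (n + 1) → ℂ) F := by
  have h := congrArg (eval (Fin.snoc (t • c) 1 : Fin (n + 1) → ℂ)) hF.sum_X_mul_pderiv
  simp only [map_add, map_sum, map_mul, eval_X, Fin.sum_univ_castSucc, Fin.snoc_castSucc, Fin.snoc_last,
    nsmul_eq_mul, map_natCast, Pi.smul_apply, smul_eq_mul, one_mul] at h
  rw [← h, Finset.mul_sum]
  simp only [mul_assoc]

/-- The zeros of `F(t c, 1)` in `t` are simple if and only if those of `F(c, s)` in `s` are. -/
theorem simple_zeros_iff {F : MvPolynomial (Fin (n + 1)) ℂ} {d : ℕ} (hF : F.IsHomogeneous d)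
    (c : Fin n → ℂ) (h1 : eval (Fin.snoc 0 1 : Fin (n + 1) → ℂ) F ≠ 0)
    (h0 : eval (Fin.snoc c 0 : Fin (n + 1) → ℂ) F ≠ 0) :
    (∀ t : ℂ, eval (Fin.snoc (t • c) 1 : Fin (n + 1) → ℂ) F = 0 →
      ∑ i, c i * eval (Fin.snoc (t • c) 1 : Fin (n + 1) → ℂ) (pderiv i.castSucc F) ≠ 0) ↔
    ∀ s : ℂ, eval (Fin.snoc c s : Fin (n + 1) → ℂ) F = 0 →
      eval (Fin.snoc c s : Fin (n + 1) → ℂ) (pderiv (Fin.last n) F) ≠ 0 := by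
  -- Here `(t c, 1) = t (c, 1/t)`, and at a zero of `F` Euler's identity makes `t` times the
  -- derivative along `c` the negative of the last partial. The hypotheses `h1` and `h0` exclude `t
  -- = 0` and `s = 0`.
  have key : ∀ t : ℂ, t ≠ 0 →
      (eval (Fin.snoc (t • c) 1 : Fin (n + 1) → ℂ) F = 0 ↔
        eval (Fin.snoc c t⁻¹ : Fin (n + 1) → ℂ) F = 0) ∧
      (eval (Fin.snoc (t • c) 1 : Fin (n + 1) → ℂ) F = 0 →
        (∑ i, c i * eval (Fin.snoc (t • c) 1 : Fin (n + 1) → ℂ) (pderiv i.castSucc F) = 0 ↔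
          eval (Fin.snoc c t⁻¹ : Fin (n + 1) → ℂ) (pderiv (Fin.last n) F) = 0)) := by
    intro t ht
    have hy : (Fin.snoc (t • c) 1 : Fin (n + 1) → ℂ) = t • Fin.snoc c t⁻¹ := by
      rw [smul_snoc, mul_inv_cancel₀ ht]
    constructor
    · rw [hy, eval_smul_of_isHomogeneous hF]
      simp [ht]
    · intro hz
      have he := euler_snoc hF c t
      rw [hz, mul_zero] at he
      have hl : eval (Fin.snoc (t • c) 1 : Fin (n + 1) → ℂ) (pderiv (Fin.last n) F) = 0 ↔
          eval (Fin.snoc c t⁻¹ : Fin (n + 1) → ℂ) (pderiv (Fin.last n) F) = 0 := by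
        rw [hy, eval_smul_of_isHomogeneous hF.pderiv]
        simp [ht]
      rw [← hl]
      constructor
      · intro h
        simpa [h] using he
      · intro h
        simpa [h, ht] using he
  constructor
  · intro h s hs
    have hs0 : s ≠ 0 := by
      rintro rfl
      exact h0 hs
    obtain ⟨k1, k2⟩ := key s⁻¹ (inv_ne_zero hs0)
    rw [inv_inv] at k1 k2
    have hz := k1.2 hs
    exact fun hd => h _ hz ((k2 hz).2 hd)
  · intro h t hz
    have ht : t ≠ 0 := by
      rintro rfl
      rw [zero_smul] at hz
      exact h1 hz
    obtain ⟨k1, k2⟩ := key t ht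
    exact fun hd => h _ (k1.1 hz) ((k2 hz).1 hd)

/-! ### Linear substitutions -/

theorem eval_substRow (M : Matrix (Fin (n + 1)) (Fin (n + 1)) ℂ)
    (F : MvPolynomial (Fin (n + 1)) ℂ) (x : Fin (n + 1) → ℂ) :
    eval x (substRow M F) = eval (Matrix.vecMul x M) F := by
  induction F using MvPolynomial.induction_on with
  | C a => simp [substRow]
  | add p q hp hq => simp only [substRow, map_add] at hp hq ⊢; rw [hp, hq]
  | mul_X p i hp =>
    simp only [substRow, map_mul] at hp ⊢
    rw [hp, bind₁_X_right]
    simp [Matrix.vecMul, dotProduct]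

/-- The chain rule for a linear substitution. -/
theorem eval_pderiv_substRow (M : Matrix (Fin (n + 1)) (Fin (n + 1)) ℂ)
    (F : MvPolynomial (Fin (n + 1)) ℂ) (x : Fin (n + 1) → ℂ) (j : Fin (n + 1)) :
    eval x (pderiv j (substRow M F)) =
      ∑ i, M j i * eval (Matrix.vecMul x M) (pderiv i F) := by
  induction F using MvPolynomial.induction_on with
  | C a => simp [substRow]
  | add p q hp hq =>
    simp only [substRow, map_add, mul_add, Finset.sum_add_distrib] at hp hq ⊢
    rw [hp, hq]
  | mul_X p i hp =>
    have hX : eval x (pderiv j (substRow M (X i))) = M j i := by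
      simp only [substRow, bind₁_X_right, map_sum, Derivation.leibniz, smul_eq_mul,
        map_mul, pderiv_C, pderiv_X, mul_zero, zero_add, eval_C]
      rw [Finset.sum_eq_single j] <;> simp +contextual
    have hmul : substRow M (p * X i) = substRow M p * substRow M (X i) := map_mul _ _ _
    have hX' : eval x (substRow M (X i)) = Matrix.vecMul x M i := by
      rw [eval_substRow, eval_X]
    simp only [hmul, Derivation.leibniz, smul_eq_mul, map_add, map_mul, hp, hX, hX',
      eval_substRow, mul_add, Finset.sum_add_distrib, eval_X, pderiv_X]
    congr 1
    · rw [Finset.sum_eq_single i]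
      · simp [mul_comm]
      · intro b _ hb
        simp [hb.symm]
      · simp
    · rw [Finset.mul_sum]
      exact Finset.sum_congr rfl fun b _ => by ring

theorem isHomogeneous_substRow (M : Matrix (Fin (n + 1)) (Fin (n + 1)) ℂ)
    {F : MvPolynomial (Fin (n + 1)) ℂ} {d : ℕ} (hF : F.IsHomogeneous d) :
    (substRow M F).IsHomogeneous d := by
  have h := hF.aeval (fun i => ∑ j : Fin (n + 1), X j * C (M j i)) (n := 1) fun i =>
    IsHomogeneous.sum _ _ _ fun j _ => by
      simpa using (isHomogeneous_X ℂ j).mul (isHomogeneous_C (Fin (n + 1)) (M j i))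
  rwa [one_mul] at h

theorem prod_substRow (M : Matrix (Fin (n + 1)) (Fin (n + 1)) ℂ) {k : ℕ}
    (R : Fin k → MvPolynomial (Fin (n + 1)) ℂ) :
    ∏ s, substRow M (R s) = substRow M (∏ s, R s) := by
  simp only [substRow, map_prod]

theorem border_castSucc_castSucc (C : Matrix (Fin n) (Fin n) ℂ) (i j : Fin n) :
    border C i.castSucc j.castSucc = C i j := by
  have h (i : Fin n) : i.castSucc = finSumFinEquiv (m := n) (n := 1) (Sum.inl i) := rfl
  simp only [border, h, Matrix.reindex_apply, Matrix.submatrix_apply, Equiv.symm_apply_apply,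
    Matrix.fromBlocks_apply₁₁]

theorem border_castSucc_last (C : Matrix (Fin n) (Fin n) ℂ) (i : Fin n) :
    border C i.castSucc (Fin.last n) = 0 := by
  have h (i : Fin n) : i.castSucc = finSumFinEquiv (m := n) (n := 1) (Sum.inl i) := rfl
  have h' : Fin.last n = finSumFinEquiv (m := n) (n := 1) (Sum.inr 0) := rfl
  simp only [border, h, h', Matrix.reindex_apply, Matrix.submatrix_apply, Equiv.symm_apply_apply,
    Matrix.fromBlocks_apply₁₂, Matrix.zero_apply]

theorem border_last_castSucc (C : Matrix (Fin n) (Fin n) ℂ) (i : Fin n) :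
    border C (Fin.last n) i.castSucc = 0 := by
  have h (i : Fin n) : i.castSucc = finSumFinEquiv (m := n) (n := 1) (Sum.inl i) := rfl
  have h' : Fin.last n = finSumFinEquiv (m := n) (n := 1) (Sum.inr 0) := rfl
  simp only [border, h, h', Matrix.reindex_apply, Matrix.submatrix_apply, Equiv.symm_apply_apply,
    Matrix.fromBlocks_apply₂₁, Matrix.zero_apply]

theorem border_last_last (C : Matrix (Fin n) (Fin n) ℂ) :
    border C (Fin.last n) (Fin.last n) = 1 := by
  have h' : Fin.last n = finSumFinEquiv (m := n) (n := 1) (Sum.inr 0) := rfl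
  simp only [border, h', Matrix.reindex_apply, Matrix.submatrix_apply, Equiv.symm_apply_apply,
    Matrix.fromBlocks_apply₂₂, Matrix.one_apply_eq]

theorem vecMul_border (C : Matrix (Fin n) (Fin n) ℂ) (x : Fin (n + 1) → ℂ) :
    Matrix.vecMul x (border C) =
      Fin.snoc (Matrix.vecMul (fun i => x i.castSucc) C) (x (Fin.last n)) := by
  ext i
  refine Fin.lastCases ?_ (fun i => ?_) i <;>
  simp [Matrix.vecMul, dotProduct, Fin.sum_univ_castSucc, border_castSucc_castSucc,
    border_castSucc_last, border_last_castSucc, border_last_last]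

/-- Homogeneous coordinates of the points of the line `coordLine j`. -/
def linePoint (j : Fin n) (t : ℂ) : Fin (n + 1) → ℂ :=
  Pi.single j.castSucc t + Pi.single (Fin.last n) 1

theorem linePoint_ne_zero (j : Fin n) (t : ℂ) : linePoint j t ≠ 0 := by
  intro h
  simpa [linePoint, (Fin.castSucc_lt_last j).ne'] using congrFun h (Fin.last n)

theorem vecMul_linePoint_border (C : Matrix (Fin n) (Fin n) ℂ) (j : Fin n) (t : ℂ) :
    Matrix.vecMul (linePoint j t) (border C) = Fin.snoc (t • C j) 1 := by
  rw [vecMul_border]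
  have h1 : (fun i : Fin n => linePoint j t i.castSucc) = Pi.single j t := by
    ext i
    simp [linePoint, Pi.single_apply, (Fin.castSucc_lt_last i).ne]
  have h2 : linePoint j t (Fin.last n) = 1 := by
    simp [linePoint, (Fin.castSucc_lt_last j).ne']
  rw [h1, h2, Matrix.single_vecMul]
  rfl

/-! ### The determinant of the pencil -/

theorem eval_detPoly (A : Fin n → Matrix (Fin N) (Fin N) ℂ) (x : Fin (n + 1) → ℂ) :
    eval x (detPoly A) = (pencil A x).det := by
  rw [detPoly, RingHom.map_det]
  congr 1
  ext a b
  simp [pencil, Matrix.sum_apply, Matrix.one_apply, apply_ite (eval x)]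

theorem pencil_transform (A : Fin n → Matrix (Fin N) (Fin N) ℂ) (C : Matrix (Fin n) (Fin n) ℂ)
    (x : Fin (n + 1) → ℂ) :
    pencil (transform C A) x = pencil A (Matrix.vecMul x (border C)) := by
  rw [vecMul_border]
  simp only [pencil, transform, Fin.snoc_castSucc, Fin.snoc_last, Matrix.vecMul, dotProduct,
    Finset.smul_sum, Finset.sum_smul, smul_smul]
  rw [Finset.sum_comm]

theorem eval_detPoly_snoc_single (A : Fin n → Matrix (Fin N) (Fin N) ℂ) (j : Fin n) :
    eval (Fin.snoc (Pi.single j 1) 0 : Fin (n + 1) → ℂ) (detPoly A) = (A j).det := by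
  rw [eval_detPoly]
  congr 1
  simp [pencil, Pi.single_apply]

theorem eval_detPoly_snoc_zero_one (A : Fin n → Matrix (Fin N) (Fin N) ℂ) :
    eval (Fin.snoc 0 1 : Fin (n + 1) → ℂ) (detPoly A) ≠ 0 := by
  rw [eval_detPoly]
  simp [pencil, Matrix.det_neg]

theorem lastVarEquiv_detPoly (A : Fin n → Matrix (Fin N) (Fin N) ℂ) :
    lastVarEquiv n (detPoly A) =
      (-(∑ j : Fin n, (X j : MvPolynomial (Fin n) ℂ) •
        (A j).map (C : ℂ →+* MvPolynomial (Fin n) ℂ)).charmatrix).det := by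
  rw [detPoly, AlgEquiv.map_det]
  congr 1
  ext1 a b
  simp only [AlgEquiv.mapMatrix_apply, Matrix.map_apply, Matrix.sub_apply, Matrix.sum_apply,
    Matrix.smul_apply, smul_eq_mul, map_sub, map_sum, map_mul, lastVarEquiv_X_castSucc,
    lastVarEquiv_X_last, lastVarEquiv_C, Matrix.neg_apply, Matrix.charmatrix_apply, neg_sub,
    Matrix.diagonal_apply, Matrix.one_apply, apply_ite (lastVarEquiv n), map_zero,
    mul_ite, mul_one, mul_zero]

/-- `Q` is the characteristic polynomial of `∑ x_j A_j`, which differs from the determinant by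
`(-1)^N`. Divisors of a monic polynomial are primitive with unit leading coefficient. -/
theorem exists_monic_lastVarEquiv_detPoly_dvd (A : Fin n → Matrix (Fin N) (Fin N) ℂ) :
    ∃ Q : Polynomial (MvPolynomial (Fin n) ℂ), Q.Monic ∧ lastVarEquiv n (detPoly A) ∣ Q := by
  have hdvd (M : Matrix (Fin N) (Fin N) (MvPolynomial (Fin n) ℂ)) :
      (-M.charmatrix).det ∣ M.charpoly := by
    rw [Matrix.det_neg, ← Matrix.charpoly]
    rcases neg_one_pow_eq_or (Polynomial (MvPolynomial (Fin n) ℂ)) (Fintype.card (Fin N))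
      with h | h
    · rw [h, one_mul]
    · rw [h, neg_one_mul, neg_dvd]
  rw [lastVarEquiv_detPoly]
  exact ⟨_, Matrix.charpoly_monic _, hdvd _⟩

/-! ### The radical of the determinant -/

section Radical

variable {k : ℕ} {A : Fin n → Matrix (Fin N) (Fin N) ℂ}
  {R : Fin k → MvPolynomial (Fin (n + 1)) ℂ} {l m : Fin k → ℕ}

theorem IsFactorization.prod_dvd (hR : IsFactorization A R l m) : ∏ s, R s ∣ detPoly A := by
  rw [hR.det_eq]
  exact Finset.prod_dvd_prod_of_dvd _ _ fun s _ => dvd_pow_self _ (hR.mult_pos s).ne'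

theorem IsFactorization.eval_prod_eq_zero_iff (hR : IsFactorization A R l m)
    (x : Fin (n + 1) → ℂ) : eval x (∏ s, R s) = 0 ↔ (pencil A x).det = 0 := by
  rw [← eval_detPoly, hR.det_eq]
  simp only [map_prod, map_pow, Finset.prod_eq_zero_iff, Finset.mem_univ, true_and]
  exact exists_congr fun s => (pow_eq_zero_iff (hR.mult_pos s).ne').symm

theorem IsFactorization.isHomogeneous_prod (hR : IsFactorization A R l m) :
    (∏ s, R s).IsHomogeneous (∑ s, l s) :=
  IsHomogeneous.prod _ _ _ fun s _ => hR.homogeneous s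

/-- The discriminant of the radical of `det A(x)` with respect to `xₙ₊₁`. -/
def discPoly (R : Fin k → MvPolynomial (Fin (n + 1)) ℂ) : MvPolynomial (Fin n) ℂ :=
  (lastVarEquiv n (∏ s, R s)).resultant (lastVarEquiv n (∏ s, R s)).derivative

theorem IsFactorization.isUnit_leadingCoeff (hR : IsFactorization A R l m) :
    IsUnit (lastVarEquiv n (∏ s, R s)).leadingCoeff := by
  obtain ⟨Q, hQ, hd⟩ := exists_monic_lastVarEquiv_detPoly_dvd A
  exact hQ.isUnit_leadingCoeff_of_dvd ((map_dvd (lastVarEquiv n) hR.prod_dvd).trans hd)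

theorem IsFactorization.discPoly_ne_zero (hR : IsFactorization A R l m) : discPoly R ≠ 0 := by
  obtain ⟨Q, hQ, hd⟩ := exists_monic_lastVarEquiv_detPoly_dvd A
  let K := FractionRing (MvPolynomial (Fin n) ℂ)
  -- Gauss's lemma needs a gcd structure; unique factorization supplies one.
  let _ : NormalizedGCDMonoid (MvPolynomial (Fin n) ℂ) :=
    Classical.choice (inferInstance : Nonempty (NormalizedGCDMonoid (MvPolynomial (Fin n) ℂ)))
  have : CharZero K :=
    charZero_of_injective_algebraMap (IsFractionRing.injective (MvPolynomial (Fin n) ℂ) K)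
  have hsep : ((∏ s, lastVarEquiv n (R s)).map
      (algebraMap (MvPolynomial (Fin n) ℂ) K)).Separable := by
    refine separable_map_prod_fractionRing _ (fun s => ?_) (fun s => ?_) fun s t hst h => ?_
    · refine Polynomial.isPrimitive_of_dvd hQ.isPrimitive (dvd_trans ?_ hd)
      exact map_dvd (lastVarEquiv n)
        ((Finset.dvd_prod_of_mem R (Finset.mem_univ s)).trans hR.prod_dvd)
    · exact (MulEquiv.irreducible_iff (lastVarEquiv n)).2 (hR.irreducible s)
    · refine hR.distinct s t hst ?_
      simpa using h.map (lastVarEquiv n).symm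
  rw [← map_prod, separable_map_iff_resultant_ne_zero _ _ hR.isUnit_leadingCoeff] at hsep
  intro h
  rw [discPoly] at h
  rw [h, map_zero] at hsep
  exact hsep rfl

theorem IsFactorization.eval_discPoly_ne_zero_iff (hR : IsFactorization A R l m)
    (c : Fin n → ℂ) : eval c (discPoly R) ≠ 0 ↔
      ∀ s : ℂ, eval (Fin.snoc c s : Fin (n + 1) → ℂ) (∏ s, R s) = 0 →
        eval (Fin.snoc c s : Fin (n + 1) → ℂ) (pderiv (Fin.last n) (∏ s, R s)) ≠ 0 := by
  rw [discPoly, ← separable_map_iff_resultant_ne_zero _ _ hR.isUnit_leadingCoeff,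
    separable_iff_forall_root]
  simp only [Polynomial.derivative_map, ← lastVarEquiv_pderiv_last, eval_map_lastVarEquiv]

theorem mk_mem_coordLine_iff (j : Fin n) (x : Fin (n + 1) → ℂ) (hx : x ≠ 0) :
    Projectivization.mk ℂ x hx ∈ coordLine j ↔
      ∃ (a t : ℂ), a ≠ 0 ∧ x = a • linePoint j t := by
  constructor
  · rintro ⟨t, h, e⟩
    obtain ⟨a, ha⟩ := (Projectivization.mk_eq_mk_iff ℂ _ _ _ _).1 e
    exact ⟨a, t, a.ne_zero, ha.symm⟩
  · rintro ⟨a, t, ha, e⟩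
    exact ⟨t, linePoint_ne_zero j t,
      (Projectivization.mk_eq_mk_iff ℂ _ _ _ _).2 ⟨Units.mk0 a ha, e.symm⟩⟩

/-- Homogeneity lets the condition be tested at `linePoint j t` alone, where the chain rule gives
the derivative of the radical along the row `C j`. -/
theorem IsFactorization.deriv_ne_zero_iff (hR : IsFactorization A R l m)
    (C : Matrix (Fin n) (Fin n) ℂ) (j : Fin n) :
    (∀ (x : Fin (n + 1) → ℂ) (hx : x ≠ 0),
      Projectivization.mk ℂ x hx ∈ spec (transform C A) ∩ coordLine j →
        eval x (pderiv j.castSucc (∏ s, substRow (border C) (R s))) ≠ 0) ↔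
    ∀ t : ℂ, eval (Fin.snoc (t • C j) 1 : Fin (n + 1) → ℂ) (∏ s, R s) = 0 →
      ∑ i, C j i * eval (Fin.snoc (t • C j) 1 : Fin (n + 1) → ℂ)
        (pderiv i.castSucc (∏ s, R s)) ≠ 0 := by
  have hder : ∀ t : ℂ, eval (linePoint j t)
      (pderiv j.castSucc (∏ s, substRow (border C) (R s))) =
      ∑ i, C j i * eval (Fin.snoc (t • C j) 1 : Fin (n + 1) → ℂ)
        (pderiv i.castSucc (∏ s, R s)) := by
    intro t
    rw [prod_substRow, eval_pderiv_substRow, vecMul_linePoint_border, Fin.sum_univ_castSucc]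
    simp only [border_castSucc_castSucc, border_castSucc_last, zero_mul, add_zero]
  have hmem : ∀ t : ℂ, eval (Fin.snoc (t • C j) 1 : Fin (n + 1) → ℂ) (∏ s, R s) = 0 ↔
      (pencil (transform C A) (linePoint j t)).det = 0 := by
    intro t
    rw [pencil_transform, vecMul_linePoint_border, hR.eval_prod_eq_zero_iff]
  simp only [← hder, hmem]
  constructor
  · intro h t ht
    refine h _ (linePoint_ne_zero j t) ⟨(mk_mem_spec _ _ _).2 ht, ?_⟩
    exact (mk_mem_coordLine_iff j _ _).2 ⟨1, t, one_ne_zero, (one_smul _ _).symm⟩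
  · rintro h x hx ⟨hs, hl⟩
    obtain ⟨a, t, ha, rfl⟩ := (mk_mem_coordLine_iff j x hx).1 hl
    rw [mk_mem_spec, pencil_smul, Matrix.det_smul, mul_eq_zero] at hs
    rw [prod_substRow, eval_smul_of_isHomogeneous
      (isHomogeneous_substRow _ hR.isHomogeneous_prod).pderiv, ← prod_substRow]
    exact mul_ne_zero (pow_ne_zero _ ha) (h t (hs.resolve_left (pow_ne_zero _ ha)))

theorem IsFactorization.isAdmissible_iff (hR : IsFactorization A R l m)
    {C : Matrix (Fin n) (Fin n) ℂ} (hC : IsUnit C) (hCA : C ∈ allowed A)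
    (h0 : ∀ j, eval (Fin.snoc (C j) 0 : Fin (n + 1) → ℂ) (detPoly A) ≠ 0) :
    IsAdmissible A R C ↔ ∏ j, eval (C j) (discPoly R) ≠ 0 := by
  have hj : ∀ j, _ ↔ eval (C j) (discPoly R) ≠ 0 := fun j =>
    ((hR.deriv_ne_zero_iff C j).trans (simple_zeros_iff hR.isHomogeneous_prod (C j)
      (by rw [Ne, hR.eval_prod_eq_zero_iff, ← eval_detPoly]; exact eval_detPoly_snoc_zero_one A)
      (by rw [Ne, hR.eval_prod_eq_zero_iff, ← eval_detPoly]; exact h0 j))).trans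
      (hR.eval_discPoly_ne_zero_iff (C j)).symm
  rw [Finset.prod_ne_zero_iff]
  constructor
  · exact fun h j _ => (hj j).1 (h.deriv_ne_zero j)
  · exact fun h => ⟨hC, hCA, fun j => (hj j).2 (h j (Finset.mem_univ j))⟩

/-- The matrices near the identity for which admissibility is governed by `discPoly`. -/
def goodNhd (A : Fin n → Matrix (Fin N) (Fin N) ℂ) : Set (Matrix (Fin n) (Fin n) ℂ) :=
  {C | C.det ≠ 0 ∧ ∀ j, eval (Fin.snoc (C j) 0 : Fin (n + 1) → ℂ) (detPoly A) ≠ 0}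

theorem isOpen_goodNhd (A : Fin n → Matrix (Fin N) (Fin N) ℂ) : IsOpen (goodNhd A) := by
  have h1 : IsOpen {C : Matrix (Fin n) (Fin n) ℂ | C.det ≠ 0} :=
    isOpen_ne_fun (continuous_id.matrix_det) continuous_const
  have h2 : IsOpen {C : Matrix (Fin n) (Fin n) ℂ |
      ∀ j, eval (Fin.snoc (C j) 0 : Fin (n + 1) → ℂ) (detPoly A) ≠ 0} := by
    rw [Set.ofPred_forall]
    refine isOpen_iInter_of_finite fun j => isOpen_ne_fun ?_ continuous_const
    refine (MvPolynomial.continuous_eval _).comp (continuous_pi fun i => ?_)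
    refine Fin.lastCases ?_ (fun i => ?_) i
    · simpa using continuous_const
    · simpa using continuous_id.matrix_elem j i
  exact h1.inter h2

/-- The invertibility of the `A j` enters here. -/
theorem one_mem_goodNhd (hA : ∀ j, IsUnit (A j)) : 1 ∈ goodNhd A := by
  refine ⟨by simp, fun j => ?_⟩
  have h : (1 : Matrix (Fin n) (Fin n) ℂ) j = Pi.single j 1 := by
    ext i
    simp [Matrix.one_apply, Pi.single_apply, eq_comm]
  rw [h, eval_detPoly_snoc_single]
  exact ((Matrix.isUnit_iff_isUnit_det _).1 (hA j)).ne_zero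

theorem one_mem_allowed (A : Fin n → Matrix (Fin N) (Fin N) ℂ) : 1 ∈ allowed A := by
  intro _ i j
  rw [Matrix.one_apply]
  split_ifs <;> simp

end Radical

/-! ### Density -/

theorem exists_real_eval_ne_zero {F : MvPolynomial (Fin n) ℂ} (hF : F ≠ 0) :
    ∃ c : Fin n → ℝ, eval (fun i => (c i : ℂ)) F ≠ 0 := by
  by_contra! h
  refine hF (MvPolynomial.funext_set (fun _ => Set.range ((↑) : ℝ → ℂ))
    (fun _ => Set.infinite_range_of_injective Complex.ofReal_injective) fun x hx => ?_)
  choose c hc using fun i => hx i (Set.mem_univ i)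
  have hx' : x = fun i => (c i : ℂ) := _root_.funext fun i => (hc i).symm
  rw [hx', h c, map_zero]

theorem polynomial_eval_aeval {σ : Type*} (g : σ → Polynomial ℂ) (F : MvPolynomial σ ℂ) (z : ℂ) :
    (aeval g F).eval z = eval (fun i => (g i).eval z) F := by
  induction F using MvPolynomial.induction_on with
  | C a => simp
  | add p q hp hq => simp [hp, hq]
  | mul_X p i hp => simp [hp]

theorem eventually_real_line_eval_ne_zero {F : MvPolynomial (Fin n) ℂ}
    (C₀ : Matrix (Fin n) (Fin n) ℂ) {c : Fin n → ℂ} (hc : eval c F ≠ 0) :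
    ∀ᶠ ε : ℝ in 𝓝[≠] 0,
      ∏ j, eval (fun i => C₀ j i + (ε : ℂ) * (c i - C₀ j i)) F ≠ 0 := by
  let Q : Polynomial ℂ := ∏ j, aeval
    (fun i => Polynomial.C (C₀ j i) + Polynomial.X * Polynomial.C (c i - C₀ j i)) F
  have hQ : ∀ z : ℂ, Q.eval z = ∏ j, eval (fun i => C₀ j i + z * (c i - C₀ j i)) F := by
    intro z
    simp only [Q, Polynomial.eval_prod]
    refine Finset.prod_congr rfl fun j _ => ?_
    rw [polynomial_eval_aeval]
    simp
  -- At parameter `1` every row has become `c`, where `F` does not vanish.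
  have hQ0 : Q ≠ 0 := by
    intro h
    have h1 := hQ 1
    rw [h, Polynomial.eval_zero] at h1
    simp only [one_mul, add_sub_cancel] at h1
    exact Finset.prod_ne_zero_iff.2 (fun _ _ => hc) h1.symm
  have hfin : {ε : ℝ | Q.IsRoot (ε : ℂ)}.Finite :=
    (Polynomial.finite_setOfPred_isRoot hQ0).preimage Complex.ofReal_injective.injOn
  have hev : ∀ᶠ ε : ℝ in 𝓝[≠] 0, ε ∉ {ε : ℝ | Q.IsRoot (ε : ℂ)} := by
    -- The parameter `0` may itself be a root, so it is removed from the finite set.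
    have hnhds : ({ε : ℝ | Q.IsRoot (ε : ℂ)} \ {0})ᶜ ∈ 𝓝 (0 : ℝ) :=
      (hfin.sdiff).isClosed.isOpen_compl.mem_nhds (by simp)
    filter_upwards [mem_nhdsWithin_of_mem_nhds hnhds, self_mem_nhdsWithin] with ε h1 h2 h3
    exact h1 ⟨h3, h2⟩
  filter_upwards [hev] with ε hε
  rw [← hQ]
  exact hε

theorem line_mem_allowed {A : Fin n → Matrix (Fin N) (Fin N) ℂ} {C₀ : Matrix (Fin n) (Fin n) ℂ}
    (hC : C₀ ∈ allowed A) (c : Fin n → ℝ) (ε : ℝ) :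
    Matrix.of (fun j i => C₀ j i + (ε : ℂ) * ((c i : ℂ) - C₀ j i)) ∈ allowed A := by
  intro h j i
  simp [hC h j i]

/-- In a relatively open set of allowed matrices, a nonzero polynomial condition on all rows
can be satisfied arbitrarily close to any matrix. -/
theorem exists_mem_allowed_prod_eval_ne_zero (A : Fin n → Matrix (Fin N) (Fin N) ℂ)
    {F : MvPolynomial (Fin n) ℂ} (hF : F ≠ 0) {C₀ : Matrix (Fin n) (Fin n) ℂ}
    (hC : C₀ ∈ allowed A) {V : Set (Matrix (Fin n) (Fin n) ℂ)} (hV : V ∈ 𝓝 C₀) :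
    ∃ C ∈ V, C ∈ allowed A ∧ ∏ j, eval (C j) F ≠ 0 := by
  obtain ⟨c, hc⟩ := exists_real_eval_ne_zero hF
  have hcont : Continuous fun ε : ℝ =>
      -- All rows move towards one real point `c`; since `c` and `ε` are real, the segment respects
      -- the reality requirement.
      Matrix.of (fun j i => C₀ j i + (ε : ℂ) * ((c i : ℂ) - C₀ j i)) := by
    refine continuous_matrix fun j i => ?_
    simp only [Matrix.of_apply]
    fun_prop
  have h0 : Matrix.of (fun j i => C₀ j i + ((0 : ℝ) : ℂ) * ((c i : ℂ) - C₀ j i)) = C₀ := by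
    ext j i
    simp
  have hev : ∀ᶠ ε : ℝ in 𝓝[≠] 0,
      Matrix.of (fun j i => C₀ j i + (ε : ℂ) * ((c i : ℂ) - C₀ j i)) ∈ V :=
    (hcont.tendsto 0 |>.eventually_mem (by rwa [h0])).filter_mono nhdsWithin_le_nhds
  obtain ⟨ε, h1, h2⟩ := (hev.and (eventually_real_line_eval_ne_zero C₀ hc)).exists
  exact ⟨_, h1, line_mem_allowed hC c ε, h2⟩

/-! ### Regular points -/

theorem IsFactorization.isRegularPoint {k : ℕ} {A : Fin n → Matrix (Fin N) (Fin N) ℂ}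
    {R : Fin k → MvPolynomial (Fin (n + 1)) ℂ} {l m : Fin k → ℕ} (hR : IsFactorization A R l m)
    {C : Matrix (Fin n) (Fin n) ℂ} (hC : IsAdmissible A R C) (j : Fin n)
    {p : ℙ ℂ (Fin (n + 1) → ℂ)} (hp : p ∈ spec (transform C A) ∩ coordLine j) :
    IsRegularPoint (spec (transform C A)) p := by
  refine ⟨hp.1, ∏ s, substRow (border C) (R s), ∑ s, l s, ?_, fun q hq => ?_, j.castSucc, ?_⟩
  · rw [prod_substRow]
    exact isHomogeneous_substRow _ hR.isHomogeneous_prod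
  · rw [prod_substRow, eval_substRow, hR.eval_prod_eq_zero_iff, ← pencil_transform]
    exact hq
  · exact hC.deriv_ne_zero j p.rep p.rep_nonzero (by rwa [Projectivization.mk_rep])

end JointSpectrum

end

theorem mainTheorem3 {n N k : ℕ} (A : Fin n → Matrix (Fin N) (Fin N) ℂ)
    (hA : ∀ j, IsUnit (A j))
    (R : Fin k → MvPolynomial (Fin (n + 1)) ℂ) (l m : Fin k → ℕ)
    (hR : JointSpectrum.IsFactorization A R l m) :
    -- every neighbourhood of the identity contains an admissible transformation
    (∀ U ∈ 𝓝 (1 : Matrix (Fin n) (Fin n) ℂ), ∃ C ∈ U, JointSpectrum.IsAdmissible A R C) ∧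
    -- near the identity the admissible transformations form an open dense set
    (∃ U : Set (Matrix (Fin n) (Fin n) ℂ), IsOpen U ∧ 1 ∈ U ∧
      IsOpen {C : ↥(U ∩ JointSpectrum.allowed A) | JointSpectrum.IsAdmissible A R C.1} ∧
      Dense {C : ↥(U ∩ JointSpectrum.allowed A) | JointSpectrum.IsAdmissible A R C.1}) ∧
    -- after an admissible transformation all points on the coordinate lines are regular
    (∀ C, JointSpectrum.IsAdmissible A R C → ∀ j : Fin n,
      ∀ p ∈ JointSpectrum.spec (JointSpectrum.transform C A) ∩ JointSpectrum.coordLine j,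
        JointSpectrum.IsRegularPoint (JointSpectrum.spec (JointSpectrum.transform C A)) p) := by
  have hD := hR.discPoly_ne_zero
  have hU := JointSpectrum.isOpen_goodNhd A
  have h1 := JointSpectrum.one_mem_goodNhd hA
  have hiff : ∀ C ∈ JointSpectrum.goodNhd A, C ∈ JointSpectrum.allowed A →
      (JointSpectrum.IsAdmissible A R C ↔
        ∏ j, MvPolynomial.eval (C j) (JointSpectrum.discPoly R) ≠ 0) := fun C hC hCA =>
    hR.isAdmissible_iff ((Matrix.isUnit_iff_isUnit_det _).2 hC.1.isUnit) hCA hC.2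
  refine ⟨fun U hUn => ?_, ⟨_, hU, h1, ?_, ?_⟩, fun C hC j p hp => hR.isRegularPoint hC j hp⟩
  · obtain ⟨C, hC, hCA, hne⟩ := JointSpectrum.exists_mem_allowed_prod_eval_ne_zero A hD
      (JointSpectrum.one_mem_allowed A) (Filter.inter_mem hUn (hU.mem_nhds h1))
    exact ⟨C, hC.1, (hiff C hC.2 hCA).2 hne⟩
  · have hset : {C : ↥(JointSpectrum.goodNhd A ∩ JointSpectrum.allowed A) |
        JointSpectrum.IsAdmissible A R C.1} = {C | ∏ j, MvPolynomial.eval (C.1 j)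
          (JointSpectrum.discPoly R) ≠ 0} :=
      Set.ext fun C => hiff C.1 C.2.1 C.2.2
    rw [hset]
    refine isOpen_ne_fun (continuous_finsetProd _ fun j _ => ?_) continuous_const
    refine (MvPolynomial.continuous_eval _).comp (continuous_pi fun i => ?_)
    exact continuous_subtype_val.matrix_elem j i
  · intro C₀
    rw [mem_closure_iff_nhds]
    intro W hW
    obtain ⟨V, hV, hVW⟩ := mem_nhds_subtype _ _ _ |>.1 hW
    obtain ⟨C, hC, hCA, hne⟩ := JointSpectrum.exists_mem_allowed_prod_eval_ne_zero A hD
      C₀.2.2 (Filter.inter_mem hV (hU.mem_nhds C₀.2.1))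
    exact ⟨⟨C, hC.2, hCA⟩, hVW hC.1, (hiff C hC.2 hCA).2 hne⟩
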